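/- Let $E$ be a real Banach lattice with topological dual $E'$ (a Banach lattice for the order $f\le g$ iff $f(x)\le g(x)$ for all $x\ge 0$). A bounded linear operator $T:E\to E$ is order bounded if it maps each subset of an order interval into an order interval. It is almost weak Dunford–Pettis (awDP) if $f_n(Tx_n)\to 0$ for all sequences $(x_n)\subset E$ and $(f_n)\subset E'$ such that $x_n\to 0$ for $\sigma(E,E')$, $f_n\to 0$ for $\sigma(E',E'')$, and both sequences are disjoint, i.e. $|x_n|\wedge|x_m|=0$ in $E$ and $|f_n|\wedge|f_m|=0$ in $E'$ whenever $n\ne m$. Let $\mathcal L_{ob}(E)$ be the algebra of all order bounded bounded linear operators from $E$ into $E$, with composition as product and with the operator norm. Then the awDP operators in $\mathcal L_{ob}(E)$ form a closed two-sided ideal of $\mathcal L_{ob}(E)$: they form a linear subspace of $\mathcal L_{ob}(E)$; if $S,T\in\mathcal L_{ob}(E)$ and one of $S,T$ is awDP, then $ST$ is awDP; and the set of awDP operators is closed in $\mathcal L_{ob}(E)$ for the topology of the operator norm. -/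

import Mathlib

open Filter Topology

namespace AlmostWeakDP

section WeakConvergence

/-- A sequence in a real Banach space `X` that converges to `0` for `σ(X, X')`.
For `X = E'` this is convergence for `σ(E', E'')`. -/
def WeaklyNull {X : Type*} [NormedAddCommGroup X] [NormedSpace ℝ X] (x : ℕ → X) : Prop :=
  Tendsto (fun n => toWeakSpace ℝ X (x n)) atTop (𝓝 0)

end WeakConvergence

section Disjointness

/-- A disjoint sequence in a vector lattice: `|x n| ∧ |x m| = 0` whenever `n ≠ m`. -/
def DisjointSeq {E : Type*} [Lattice E] [AddCommGroup E] (x : ℕ → E) : Prop :=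
  ∀ n m : ℕ, n ≠ m → |x n| ⊓ |x m| = 0

variable {E : Type*} [NormedAddCommGroup E] [NormedSpace ℝ E] [Lattice E]

/-- The order of the topological dual `E'`: `f ≤ g` when `f x ≤ g x` for every `x ≥ 0`. -/
def DualLE (f g : StrongDual ℝ E) : Prop :=
  ∀ x : E, 0 ≤ x → f x ≤ g x

/-- `u` is the modulus `|f| = f ∨ (-f)` of `f` in the ordered vector space `E'`. -/
def IsDualModulus (f u : StrongDual ℝ E) : Prop :=
  DualLE f u ∧ DualLE (-f) u ∧ ∀ v : StrongDual ℝ E, DualLE f v → DualLE (-f) v → DualLE u v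

/-- `w` is the infimum `u ∧ v` of `u` and `v` in the ordered vector space `E'`. -/
def IsDualInf (u v w : StrongDual ℝ E) : Prop :=
  DualLE w u ∧ DualLE w v ∧ ∀ z : StrongDual ℝ E, DualLE z u → DualLE z v → DualLE z w

/-- `f` and `g` are disjoint in `E'`, that is, `|f| ∧ |g| = 0`. -/
def DualDisjoint (f g : StrongDual ℝ E) : Prop :=
  ∃ u v : StrongDual ℝ E, IsDualModulus f u ∧ IsDualModulus g v ∧ IsDualInf u v 0

/-- A disjoint sequence in the Banach lattice `E'`. -/
def DualDisjointSeq (f : ℕ → StrongDual ℝ E) : Prop :=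
  ∀ n m : ℕ, n ≠ m → DualDisjoint (f n) (f m)

end Disjointness

section Operators

variable {E F : Type*} [NormedAddCommGroup E] [NormedSpace ℝ E] [Lattice E]
  [NormedAddCommGroup F] [NormedSpace ℝ F] [Lattice F]

/-- Almost weak Dunford-Pettis operators: `f n (T (x n)) → 0` for all disjoint weakly null
sequences `x` in `E` and `f` in `F'`. -/
def IsAWDP (T : E →L[ℝ] F) : Prop :=
  ∀ (x : ℕ → E) (f : ℕ → StrongDual ℝ F),
    WeaklyNull x → DisjointSeq x → WeaklyNull f → DualDisjointSeq f →
      Tendsto (fun n => f n (T (x n))) atTop (𝓝 0)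

/-- A subset of a vector lattice is order bounded if some order interval contains it. -/
def OrderBdd {G : Type*} [Lattice G] (A : Set G) : Prop :=
  ∃ a b : G, A ⊆ Set.Icc a b

/-- An operator is order bounded if it maps order bounded sets to order bounded sets. -/
def IsOrderBounded (T : E →L[ℝ] F) : Prop :=
  ∀ A : Set E, OrderBdd A → OrderBdd (T '' A)

end Operators

section Algebra

variable (E : Type*) [NormedAddCommGroup E] [NormedSpace ℝ E] [Lattice E]
  [IsOrderedAddMonoid E] [IsOrderedModule ℝ E]

/-- The algebra of all order bounded operators from `E` into `E`, a subalgebra of the algebra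
of all bounded operators (multiplication is composition), with the operator norm. -/
def orderBoundedOperators : Subalgebra ℝ (E →L[ℝ] E) where
  carrier := {T | IsOrderBounded T}
  mul_mem' := by
    intro S T hS hT A hA
    have h := hS _ (hT A hA)
    rw [Set.image_image] at h
    exact h
  add_mem' := by
    intro S T hS hT A hA
    obtain ⟨a, b, h1⟩ := hS A hA
    obtain ⟨c, d, h2⟩ := hT A hA
    refine ⟨a + c, b + d, ?_⟩
    rintro _ ⟨x, hx, rfl⟩
    have hs := h1 ⟨x, hx, rfl⟩
    have ht := h2 ⟨x, hx, rfl⟩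
    exact ⟨add_le_add hs.1 ht.1, add_le_add hs.2 ht.2⟩
  algebraMap_mem' := by
    rintro r A ⟨a, b, h⟩
    rcases le_total 0 r with hr | hr
    · refine ⟨r • a, r • b, ?_⟩
      rintro _ ⟨x, hx, rfl⟩
      exact ⟨smul_le_smul_of_nonneg_left (h hx).1 hr, smul_le_smul_of_nonneg_left (h hx).2 hr⟩
    · refine ⟨r • b, r • a, ?_⟩
      rintro _ ⟨x, hx, rfl⟩
      exact ⟨smul_le_smul_of_nonpos_left (h hx).2 hr, smul_le_smul_of_nonpos_left (h hx).1 hr⟩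

end Algebra

end AlmostWeakDP

/-! Linearity is immediate, and closedness follows because weakly null sequences are norm bounded.
The ideal property is the real content: an order bounded `S` and its adjoint need not preserve
disjointness. What they do preserve is sequences whose moduli are weakly null
(`WeaklyNull.abs_map`), and disjoint weakly null sequences are of this kind (`WeaklyNull.abs`). So
it suffices that an order bounded awDP operator satisfies `f n (T (x n)) → 0` whenever `|x n|` and
`|f n|` are weakly null; this is `IsAWDP.tendsto`.

That strengthening comes from disjointification (`exists_disjoint_approx`). For a positive weakly
null sequence, subtracting a large multiple of the earlier terms and a small multiple of a weighted
sum of all terms leaves a disjoint sequence along a subsequence. The error in the bilinear form `g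
(T y)` tends to zero because order boundedness of `T` yields functionals `h` with `f |T y| ≤ h |y|`
(`exists_dominating`). The procedure is applied first to the functionals, then to the vectors.

These `h` are Riesz-Kantorovich suprema. The same formula makes the dual a Banach lattice, so every
lattice argument also applies in `E'`. -/

set_option linter.unusedSectionVars false

namespace AlmostWeakDP

/-! ### Positive functionals and Riesz-Kantorovich suprema. -/

section PositiveFunctionals

variable {E : Type*} [NormedAddCommGroup E] [NormedSpace ℝ E] [Lattice E]
  [IsOrderedAddMonoid E] [IsOrderedModule ℝ E]

/-- An additive and positively homogeneous function on the positive cone extends linearly. -/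
theorem exists_linearMap_eqOn_cone (q : E → ℝ)
    (hadd : ∀ x y : E, 0 ≤ x → 0 ≤ y → q (x + y) = q x + q y)
    (hsmul : ∀ (c : ℝ) (x : E), 0 ≤ c → 0 ≤ x → q (c • x) = c * q x) :
    ∃ h : E →ₗ[ℝ] ℝ, ∀ x, 0 ≤ x → h x = q x := by
  -- The value of the extension does not depend on how `x` is written as a difference of positive
  -- vectors; additivity and homogeneity both reduce to this.
  have key : ∀ x a b : E, 0 ≤ a → 0 ≤ b → x = a - b → q x⁺ - q x⁻ = q a - q b := by
    intro x a b ha hb hx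
    have h1 : x⁺ + b = a + x⁻ := by
      have := posPart_sub_negPart x
      rw [hx] at this ⊢
      rw [sub_eq_sub_iff_add_eq_add] at this
      exact this
    have h2 := congrArg q h1
    rw [hadd _ _ (posPart_nonneg x) hb, hadd _ _ ha (negPart_nonneg x)] at h2
    linarith
  have hq0 : q 0 = 0 := by simpa using hsmul 0 0 le_rfl le_rfl
  have dec : ∀ x : E, x = x⁺ - x⁻ := fun x => (posPart_sub_negPart x).symm
  refine ⟨{ toFun := fun x => q x⁺ - q x⁻, map_add' := ?_, map_smul' := ?_ }, ?_⟩
  · intro x y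
    rw [key (x + y) (x⁺ + y⁺) (x⁻ + y⁻) (add_nonneg (posPart_nonneg x) (posPart_nonneg y))
      (add_nonneg (negPart_nonneg x) (negPart_nonneg y))
      (by conv_lhs => rw [dec x, dec y]
          abel), hadd _ _ (posPart_nonneg x) (posPart_nonneg y),
      hadd _ _ (negPart_nonneg x) (negPart_nonneg y)]
    ring
  · intro c x
    simp only [RingHom.id_apply, smul_eq_mul]
    rcases le_total 0 c with hc | hc
    · rw [key (c • x) (c • x⁺) (c • x⁻) (smul_nonneg hc (posPart_nonneg x))
        (smul_nonneg hc (negPart_nonneg x)) (by rw [← smul_sub, ← dec]),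
        hsmul _ _ hc (posPart_nonneg x), hsmul _ _ hc (negPart_nonneg x)]
      ring
    · have hc' : 0 ≤ -c := neg_nonneg.2 hc
      rw [key (c • x) ((-c) • x⁻) ((-c) • x⁺) (smul_nonneg hc' (negPart_nonneg x))
        (smul_nonneg hc' (posPart_nonneg x))
        (by rw [← smul_sub, ← neg_sub x⁺ x⁻, ← dec, neg_smul_neg]),
        hsmul _ _ hc' (posPart_nonneg x), hsmul _ _ hc' (negPart_nonneg x)]
      ring
  · intro x hx
    have := key x x 0 hx le_rfl (by simp)
    simpa [hq0] using this

/-- A positive linear functional on a Banach lattice is continuous. -/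
theorem exists_bound_of_nonneg [CompleteSpace E] [HasSolidNorm E] (h : E →ₗ[ℝ] ℝ)
    (hpos : ∀ x, 0 ≤ x → 0 ≤ h x) : ∃ C : ℝ, ∀ x, ‖h x‖ ≤ C * ‖x‖ := by
  have hmono : ∀ x y, x ≤ y → h x ≤ h y := fun x y hxy => by
    have := hpos (y - x) (sub_nonneg.2 hxy)
    rw [map_sub] at this
    linarith
  have habs : ∀ x, |h x| ≤ h |x| := fun x => by
    rw [abs_le]
    refine ⟨?_, hmono _ _ (le_abs_self x)⟩
    have := hmono _ _ (neg_le_abs x)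
    rw [map_neg] at this
    linarith
  by_contra! hC
  -- The norms are summable, and the sum of the series dominates each term, so `h` of the sum would
  -- exceed every `n`.
  have hC' : ∀ n : ℕ, ∃ x : E, 0 ≤ x ∧ ‖x‖ ≤ (1 / 2) ^ n ∧ (n : ℝ) ≤ h x := by
    intro n
    obtain ⟨x, hx⟩ := hC (n * 2 ^ n)
    have hx0 : 0 < ‖x‖ := by
      rw [norm_pos_iff]
      rintro rfl
      simp at hx
    refine ⟨((1 / 2) ^ n * ‖x‖⁻¹) • |x|, smul_nonneg (by positivity) (abs_nonneg x), ?_, ?_⟩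
    · rw [norm_smul, norm_abs_eq_norm, Real.norm_of_nonneg (by positivity),
        inv_mul_cancel_right₀ hx0.ne']
    · rw [map_smul, smul_eq_mul]
      have h1 : (n : ℝ) * 2 ^ n * ‖x‖ ≤ h |x| := hx.le.trans (habs x)
      calc (n : ℝ) = ((1 / 2) ^ n * ‖x‖⁻¹) * (n * 2 ^ n * ‖x‖) := by
            rw [one_div, inv_pow]
            field_simp
        _ ≤ _ := by gcongr
  choose x hx0 hxn hxh using hC'
  have hs : Summable x := Summable.of_norm_bounded summable_geometric_two hxn
  obtain ⟨n, hn⟩ := exists_nat_gt (h (∑' n, x n))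
  exact (hn.trans_le ((hxh n).trans (hmono _ _ (hs.le_tsum n fun m _ => hx0 m)))).false

/-- The sums `∑ σ (y i)` over the finite families of positive `y i` with `∑ y i ≤ x`. -/
def listSums (σ : E → ℝ) (x : E) : Set ℝ :=
  {s | ∃ l : List E, (∀ y ∈ l, 0 ≤ y) ∧ l.sum ≤ x ∧ s = (l.map σ).sum}

/-- Riesz decomposition: cut the head `a` into `a ⊓ x`, which fits under `x`, and the rest, which
fits under `y`, then continue with what remains of `x` and `y`. Subadditivity of `σ` ensures that
cutting does not decrease the sum. This is the hard half of additivity of the supremum. -/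
theorem exists_split (σ : E → ℝ) (hadd : ∀ a b, σ (a + b) ≤ σ a + σ b) (l : List E) :
    ∀ x y : E, 0 ≤ x → 0 ≤ y → (∀ z ∈ l, 0 ≤ z) → l.sum ≤ x + y →
      ∃ s ∈ listSums σ x, ∃ t ∈ listSums σ y, (l.map σ).sum ≤ s + t := by
  induction l with
  | nil =>
    intro x y hx hy _ _
    exact ⟨0, ⟨[], by simp, by simpa using hx, by simp⟩, 0, ⟨[], by simp, by simpa using hy,
      by simp⟩, by simp⟩
  | cons a l ih =>
    intro x y hx hy hl hle
    rw [List.sum_cons] at hle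
    have ha : 0 ≤ a := hl a (by simp)
    have hl' : ∀ z ∈ l, 0 ≤ z := fun z hz => hl z (by simp [hz])
    have hax : a ≤ x + y := (le_add_of_nonneg_right (List.sum_nonneg hl')).trans hle
    have hay : a - a ⊓ x ≤ y := by
      rw [sub_inf, sub_self]
      exact sup_le hy (sub_le_iff_le_add'.2 hax)
    obtain ⟨s, ⟨l₁, h1, h2, rfl⟩, t, ⟨l₂, h3, h4, rfl⟩, h⟩ :=
      ih (x - a ⊓ x) (y - (a - a ⊓ x)) (sub_nonneg.2 inf_le_right) (sub_nonneg.2 hay) hl'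
        (by
          have : x - a ⊓ x + (y - (a - a ⊓ x)) = x + y - a := by abel
          rw [this]
          exact le_sub_iff_add_le'.2 hle)
    refine ⟨_, ⟨a ⊓ x :: l₁, ?_, ?_, rfl⟩, _, ⟨(a - a ⊓ x) :: l₂, ?_, ?_, rfl⟩, ?_⟩
    · intro z hz
      rcases List.mem_cons.1 hz with rfl | hz
      · exact le_inf ha hx
      · exact h1 z hz
    · rw [List.sum_cons]
      exact le_sub_iff_add_le'.1 h2
    · intro z hz
      rcases List.mem_cons.1 hz with rfl | hz
      · exact sub_nonneg.2 inf_le_left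
      · exact h3 z hz
    · rw [List.sum_cons]
      exact le_sub_iff_add_le'.1 h4
    · have := hadd (a ⊓ x) (a - a ⊓ x)
      rw [add_sub_cancel] at this
      simp only [List.map_cons, List.sum_cons]
      linarith

theorem smul_mem_listSums {σ : E → ℝ} (hsmul : ∀ (c : ℝ) (x : E), 0 ≤ c → σ (c • x) = c * σ x)
    {c : ℝ} (hc : 0 ≤ c) {x : E} {s : ℝ} (hs : s ∈ listSums σ x) :
    c * s ∈ listSums σ (c • x) := by
  obtain ⟨l, h1, h2, rfl⟩ := hs
  refine ⟨l.map (c • ·), ?_, ?_, ?_⟩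
  · intro y hy
    obtain ⟨z, hz, rfl⟩ := List.mem_map.1 hy
    exact smul_nonneg hc (h1 z hz)
  · rw [← List.smul_sum]
    exact smul_le_smul_of_nonneg_left h2 hc
  · rw [List.map_map, ← List.sum_map_mul_left]
    congr 1
    exact List.map_congr_left fun y _ => (hsmul c y hc).symm

/-- The Riesz-Kantorovich formula: the sums in `listSums σ x` have a supremum which is linear
in `x`. -/
theorem exists_isLUB_listSums [CompleteSpace E] [HasSolidNorm E] (σ : E → ℝ)
    (hadd : ∀ a b, σ (a + b) ≤ σ a + σ b)
    (hsmul : ∀ (c : ℝ) (x : E), 0 ≤ c → σ (c • x) = c * σ x)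
    (hbdd : ∀ x, 0 ≤ x → BddAbove (listSums σ x)) :
    ∃ h : StrongDual ℝ E, ∀ x, 0 ≤ x → IsLUB (listSums σ x) (h x) := by
  have hne : ∀ x : E, 0 ≤ x → (0 : ℝ) ∈ listSums σ x := fun x hx => ⟨[], by simp, by simpa, by simp⟩
  have hlub : ∀ x : E, 0 ≤ x → IsLUB (listSums σ x) (sSup (listSums σ x)) := fun x hx =>
    isLUB_csSup ⟨0, hne x hx⟩ (hbdd x hx)
  have hle : ∀ (c : ℝ) (x : E), 0 < c → 0 ≤ x →
      c * sSup (listSums σ x) ≤ sSup (listSums σ (c • x)) := by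
    intro c x hc hx
    rw [← le_div_iff₀' hc]
    refine (hlub x hx).2 fun s hs => ?_
    rw [le_div_iff₀' hc]
    exact (hlub _ (smul_nonneg hc.le hx)).1 (smul_mem_listSums hsmul hc.le hs)
  obtain ⟨h, hh⟩ := exists_linearMap_eqOn_cone (fun x => sSup (listSums σ x)) (by
    intro x y hx hy
    apply le_antisymm
    · refine (hlub _ (add_nonneg hx hy)).2 ?_
      rintro _ ⟨l, h1, h2, rfl⟩
      obtain ⟨s, hs, t, ht, h⟩ := exists_split σ hadd l x y hx hy h1 h2
      exact h.trans (add_le_add ((hlub x hx).1 hs) ((hlub y hy).1 ht))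
    · rw [← le_sub_iff_add_le]
      refine (hlub x hx).2 fun s hs => ?_
      rw [le_sub_comm]
      refine (hlub y hy).2 fun t ht => ?_
      rw [le_sub_iff_add_le']
      refine (hlub _ (add_nonneg hx hy)).1 ?_
      obtain ⟨l₁, h1, h2, rfl⟩ := hs
      obtain ⟨l₂, h3, h4, rfl⟩ := ht
      refine ⟨l₁ ++ l₂, ?_, ?_, ?_⟩
      · intro z hz
        rcases List.mem_append.1 hz with hz | hz
        exacts [h1 z hz, h3 z hz]
      · rw [List.sum_append]
        exact add_le_add h2 h4
      · rw [List.map_append, List.sum_append]) (by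
    intro c x hc hx
    rcases hc.eq_or_lt with rfl | hc
    · simp only [zero_smul, zero_mul]
      refine le_antisymm ((hlub 0 le_rfl).2 ?_) ((hlub 0 le_rfl).1 (hne 0 le_rfl))
      rintro _ ⟨l, h1, h2, rfl⟩
      have hσ : σ 0 = 0 := by simpa using hsmul 0 0 le_rfl
      have : ∀ y ∈ l, y = 0 := fun y hy =>
        le_antisymm ((List.single_le_sum h1 y hy).trans h2) (h1 y hy)
      refine (List.sum_eq_zero ?_).le
      intro s hs
      obtain ⟨y, hy, rfl⟩ := List.mem_map.1 hs
      rw [this y hy, hσ]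
    · refine le_antisymm ?_ (hle c x hc hx)
      have := hle c⁻¹ (c • x) (inv_pos.2 hc) (smul_nonneg hc.le hx)
      rw [inv_smul_smul₀ hc.ne', inv_mul_le_iff₀ hc] at this
      exact this)
  obtain ⟨C, hC⟩ := exists_bound_of_nonneg h fun x hx => by
    rw [hh x hx]
    exact (hlub x hx).1 (hne x hx)
  refine ⟨h.mkContinuous C hC, fun x hx => ?_⟩
  rw [LinearMap.mkContinuous_apply, hh x hx]
  exact hlub x hx

end PositiveFunctionals

/-! ### Functionals dominating `f |T y|`. -/

section Domination

variable {E F : Type*} [NormedAddCommGroup E] [NormedSpace ℝ E] [Lattice E]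
  [IsOrderedAddMonoid E] [IsOrderedModule ℝ E]
  [NormedAddCommGroup F] [NormedSpace ℝ F] [Lattice F] [IsOrderedAddMonoid F]

theorem abs_smul_of_nonneg [IsOrderedModule ℝ F] {c : ℝ} (hc : 0 ≤ c) (y : F) :
    |c • y| = c • |y| := by
  rcases hc.eq_or_lt with rfl | hc
  · simp
  · rw [abs, abs, ← smul_neg]
    exact ((OrderIso.smulRight hc).map_sup y (-y)).symm

/-- The sum of the `|T y|` is the supremum of `T v` over the signed sums `v = ∑ ± y`, and each such
`v` has `|v| ≤ l.sum`. The vector `w` accumulates the terms whose sign is already chosen. -/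
theorem add_sum_abs_map_le (T : E →ₗ[ℝ] F) (z : F) (l : List E) :
    ∀ w : F, (∀ y ∈ l, 0 ≤ y) → (∀ v, |v| ≤ l.sum → w + T v ≤ z) →
      w + (l.map fun y => |T y|).sum ≤ z := by
  induction l with
  | nil =>
    intro w _ h
    simpa using h 0 (by simp)
  | cons a l ih =>
    intro w hl h
    have ha : 0 ≤ a := hl a (by simp)
    have hl' : ∀ y ∈ l, 0 ≤ y := fun y hy => hl y (by simp [hy])
    rw [List.map_cons, List.sum_cons, ← add_assoc, ← le_sub_iff_add_le, ← le_sub_iff_add_le']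
    refine sup_le ?_ ?_
    · rw [le_sub_iff_add_le', le_sub_iff_add_le]
      refine ih _ hl' fun v hv => ?_
      rw [add_assoc, ← map_add]
      refine h _ ((abs_add_le a v).trans ?_)
      rw [abs_of_nonneg ha, List.sum_cons]
      exact add_le_add le_rfl hv
    · rw [le_sub_iff_add_le', le_sub_iff_add_le]
      refine ih _ hl' fun v hv => ?_
      rw [add_assoc, ← map_neg, ← map_add]
      refine h _ ((abs_add_le (-a) v).trans ?_)
      rw [abs_neg, abs_of_nonneg ha, List.sum_cons]
      exact add_le_add le_rfl hv

theorem le_of_mem_listSums (T : E →ₗ[ℝ] F) (f : F →ₗ[ℝ] ℝ) (hf : ∀ y, 0 ≤ y → 0 ≤ f y)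
    {x : E} {z : F} (hz : ∀ v, |v| ≤ x → T v ≤ z) {s : ℝ}
    (hs : s ∈ listSums (fun y => f |T y|) x) : s ≤ f z := by
  obtain ⟨l, h1, h2, rfl⟩ := hs
  have h3 := add_sum_abs_map_le T z l 0 h1 fun v hv => by
    rw [zero_add]
    exact hz v (hv.trans h2)
  rw [zero_add, ← sub_nonneg] at h3
  have h4 := hf _ h3
  rw [map_sub, map_list_sum, List.map_map, sub_nonneg] at h4
  exact h4

/-- The functional `h` plays the role of `f ∘ |T|`. The modulus `|T|` itself may not exist, but the
suprema are taken in `ℝ` after applying `f`. -/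
theorem exists_isLUB_listSums_comp [IsOrderedModule ℝ F] [CompleteSpace E] [HasSolidNorm E]
    (T : E →ₗ[ℝ] F) (f : F →ₗ[ℝ] ℝ) (hf : ∀ y, 0 ≤ y → 0 ≤ f y)
    (hT : ∀ x, 0 ≤ x → ∃ z, ∀ v, |v| ≤ x → T v ≤ z) :
    ∃ h : StrongDual ℝ E, ∀ x, 0 ≤ x → IsLUB (listSums (fun y => f |T y|) x) (h x) := by
  refine exists_isLUB_listSums _ (fun a b => ?_) (fun c x hc => ?_) fun x hx => ?_
  · rw [map_add, ← map_add f, ← sub_nonneg, ← map_sub f]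
    exact hf _ (sub_nonneg.2 (abs_add_le _ _))
  · rw [map_smul, abs_smul_of_nonneg hc, map_smul, smul_eq_mul]
  · obtain ⟨z, hz⟩ := hT x hx
    exact ⟨f z, fun s hs => le_of_mem_listSums T f hf hz hs⟩

theorem apply_abs_le_of_isLUB (T : E →ₗ[ℝ] F) (f : F →ₗ[ℝ] ℝ) (hf : ∀ y, 0 ≤ y → 0 ≤ f y)
    {h : StrongDual ℝ E} (hh : ∀ x, 0 ≤ x → IsLUB (listSums (fun y => f |T y|) x) (h x)) (y : E) :
    f |T y| ≤ h |y| := by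
  have h1 : ∀ x, 0 ≤ x → f |T x| ≤ h x := fun x hx =>
    (hh x hx).1 ⟨[x], by simpa using hx, by simp, by simp⟩
  have h2 : |T y| ≤ |T y⁺| + |T y⁻| := by
    conv_lhs => rw [← posPart_sub_negPart y, map_sub, sub_eq_add_neg]
    exact (abs_add_le _ _).trans (by rw [abs_neg])
  have h3 := hf _ (sub_nonneg.2 h2)
  rw [map_sub, map_add] at h3
  have h4 := h1 _ (posPart_nonneg y)
  have h5 := h1 _ (negPart_nonneg y)
  rw [← posPart_add_negPart y, map_add]
  linarith

end Domination

/-! ### The dual as a Banach lattice. -/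

section DualLattice

variable {E : Type*} [NormedAddCommGroup E] [NormedSpace ℝ E] [CompleteSpace E] [Lattice E]
  [IsOrderedAddMonoid E] [IsOrderedModule ℝ E] [HasSolidNorm E]

theorem apply_le_norm_mul_norm (f : StrongDual ℝ E) {x v : E} (h : |v| ≤ x) :
    f v ≤ ‖f‖ * ‖x‖ := by
  have hx : |v| ≤ |x| := h.trans (le_abs_self x)
  calc f v ≤ ‖f v‖ := le_abs_self _
    _ ≤ ‖f‖ * ‖v‖ := f.le_opNorm v
    _ ≤ ‖f‖ * ‖x‖ := by gcongr; exact HasSolidNorm.solid hx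

theorem exists_isLUB_listSums_abs (f : StrongDual ℝ E) :
    ∃ h : StrongDual ℝ E, ∀ x, 0 ≤ x → IsLUB (listSums (fun y => |f y|) x) (h x) :=
  exists_isLUB_listSums_comp (f : E →ₗ[ℝ] ℝ) LinearMap.id (fun _ h => h) fun x _ =>
    ⟨‖f‖ * ‖x‖, fun _ => apply_le_norm_mul_norm f⟩

/-- The modulus of a functional, given by the Riesz-Kantorovich formula. -/
noncomputable def dualAbs (f : StrongDual ℝ E) : StrongDual ℝ E :=
  (exists_isLUB_listSums_abs f).choose

theorem isLUB_dualAbs (f : StrongDual ℝ E) {x : E} (hx : 0 ≤ x) :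
    IsLUB (listSums (fun y => |f y|) x) (dualAbs f x) :=
  (exists_isLUB_listSums_abs f).choose_spec x hx

theorem abs_apply_le_dualAbs (f : StrongDual ℝ E) {x : E} (hx : 0 ≤ x) : |f x| ≤ dualAbs f x :=
  (isLUB_dualAbs f hx).1 ⟨[x], by simpa using hx, by simp, by simp⟩

theorem dualAbs_apply_le {f v : StrongDual ℝ E} (h : ∀ x, 0 ≤ x → |f x| ≤ v x) {x : E}
    (hx : 0 ≤ x) : dualAbs f x ≤ v x := by
  refine (isLUB_dualAbs f hx).2 ?_
  rintro _ ⟨l, h1, h2, rfl⟩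
  calc (l.map fun y => |f y|).sum ≤ (l.map v).sum := List.sum_le_sum fun y hy => h y (h1 y hy)
    _ = v l.sum := (map_list_sum v l).symm
    _ ≤ v x := by
      have := (abs_nonneg _).trans (h _ (sub_nonneg.2 h2))
      rw [map_sub] at this
      linarith

/-- The topological dual of a Banach lattice is a lattice. -/
noncomputable instance instLatticeStrongDual : Lattice (StrongDual ℝ E) where
  le := DualLE
  le_refl f x _ := le_rfl
  le_trans f g h h1 h2 x hx := (h1 x hx).trans (h2 x hx)
  le_antisymm f g h1 h2 := by
    have h : ∀ x, 0 ≤ x → f x = g x := fun x hx => le_antisymm (h1 x hx) (h2 x hx)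
    ext x
    rw [← posPart_sub_negPart x, map_sub, map_sub, h _ (posPart_nonneg x),
      h _ (negPart_nonneg x)]
  sup f g := (1 / 2 : ℝ) • (f + g + dualAbs (f - g))
  le_sup_left f g x hx := by
    have := (abs_le.1 (abs_apply_le_dualAbs (f - g) hx)).2
    simp at this ⊢
    linarith
  le_sup_right f g x hx := by
    have := (abs_le.1 (abs_apply_le_dualAbs (f - g) hx)).1
    simp at this ⊢
    linarith
  sup_le f g h h1 h2 x hx := by
    have : dualAbs (f - g) x ≤ ((2 : ℝ) • h - f - g) x := by
      refine dualAbs_apply_le (fun y hy => ?_) hx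
      have := h1 y hy
      have := h2 y hy
      rw [abs_le]
      simp
      constructor <;> linarith
    simp at this ⊢
    linarith
  inf f g := (1 / 2 : ℝ) • (f + g - dualAbs (f - g))
  inf_le_left f g x hx := by
    have := (abs_le.1 (abs_apply_le_dualAbs (f - g) hx)).1
    simp at this ⊢
    linarith
  inf_le_right f g x hx := by
    have := (abs_le.1 (abs_apply_le_dualAbs (f - g) hx)).2
    simp at this ⊢
    linarith
  le_inf f g h h1 h2 x hx := by
    have : dualAbs (g - h) x ≤ (g + h - (2 : ℝ) • f) x := by
      refine dualAbs_apply_le (fun y hy => ?_) hx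
      have := h1 y hy
      have := h2 y hy
      rw [abs_le]
      simp
      constructor <;> linarith
    simp at this ⊢
    linarith

theorem dual_nonneg_iff {f : StrongDual ℝ E} : 0 ≤ f ↔ ∀ x, 0 ≤ x → 0 ≤ f x := Iff.rfl

instance instIsOrderedAddMonoidStrongDual : IsOrderedAddMonoid (StrongDual ℝ E) where
  add_le_add_left f g h k x hx := by
    have := h x hx
    simp only [add_apply]
    linarith

instance instIsOrderedModuleStrongDual : IsOrderedModule ℝ (StrongDual ℝ E) where
  smul_le_smul_of_nonneg_left _ hc _ _ h x hx := mul_le_mul_of_nonneg_left (h x hx) hc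
  smul_le_smul_of_nonneg_right _ hf _ _ h x hx := mul_le_mul_of_nonneg_right h (hf x hx)

theorem abs_eq_dualAbs (f : StrongDual ℝ E) : |f| = dualAbs f := by
  apply le_antisymm
  · refine sup_le (fun x hx => ?_) fun x hx => ?_
    · exact (abs_le.1 (abs_apply_le_dualAbs f hx)).2
    · have := (abs_le.1 (abs_apply_le_dualAbs f hx)).1
      rw [neg_apply]
      linarith
  · refine fun x hx => dualAbs_apply_le (fun y hy => ?_) hx
    have h1 := le_abs_self f y hy
    have h2 := neg_le_abs f y hy
    rw [neg_apply] at h2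
    exact abs_le.2 ⟨by linarith, h1⟩

theorem apply_mono {f : StrongDual ℝ E} (hf : 0 ≤ f) {x y : E} (h : x ≤ y) : f x ≤ f y := by
  have := dual_nonneg_iff.1 hf (y - x) (sub_nonneg.2 h)
  rw [map_sub] at this
  linarith

theorem abs_apply_le (f : StrongDual ℝ E) (x : E) : |f x| ≤ |f| |x| := by
  rw [abs_eq_dualAbs]
  exact apply_abs_le_of_isLUB (f : E →ₗ[ℝ] ℝ) LinearMap.id (fun _ h => h)
    (fun x hx => isLUB_dualAbs f hx) x

theorem abs_dual_apply_le_norm (f : StrongDual ℝ E) {x : E} (hx : 0 ≤ x) :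
    |f| x ≤ ‖f‖ * ‖x‖ := by
  rw [abs_eq_dualAbs]
  exact (isLUB_dualAbs f hx).2 fun s hs => le_of_mem_listSums (f : E →ₗ[ℝ] ℝ) LinearMap.id
    (fun _ h => h) (fun _ => apply_le_norm_mul_norm f) hs

instance instHasSolidNormStrongDual : HasSolidNorm (StrongDual ℝ E) where
  solid f g h := by
    refine ContinuousLinearMap.opNorm_le_bound _ (norm_nonneg g) fun x => ?_
    calc ‖f x‖ ≤ |f| |x| := abs_apply_le f x
      _ ≤ |g| |x| := h _ (abs_nonneg x)
      _ ≤ ‖g‖ * ‖|x|‖ := abs_dual_apply_le_norm g (abs_nonneg x)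
      _ = ‖g‖ * ‖x‖ := by rw [norm_abs_eq_norm]

theorem DualDisjoint.inf_eq_zero {f g : StrongDual ℝ E} (h : DualDisjoint f g) :
    |f| ⊓ |g| = 0 := by
  obtain ⟨u, v, ⟨hu1, hu2, hu3⟩, ⟨hv1, hv2, hv3⟩, hw1, hw2, hw3⟩ := h
  have hu : |f| = u := le_antisymm (sup_le hu1 hu2) (hu3 _ (le_abs_self f) (neg_le_abs f))
  have hv : |g| = v := le_antisymm (sup_le hv1 hv2) (hv3 _ (le_abs_self g) (neg_le_abs g))
  rw [hu, hv]
  exact le_antisymm (hw3 _ (inf_le_left : u ⊓ v ≤ u) (inf_le_right : u ⊓ v ≤ v)) (le_inf hw1 hw2)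

theorem dualDisjoint_of_inf_eq_zero {f g : StrongDual ℝ E} (h : |f| ⊓ |g| = 0) :
    DualDisjoint f g :=
  ⟨|f|, |g|, ⟨le_abs_self f, neg_le_abs f, fun v h1 h2 => (sup_le h1 h2 : |f| ≤ v)⟩,
    ⟨le_abs_self g, neg_le_abs g, fun v h1 h2 => (sup_le h1 h2 : |g| ≤ v)⟩,
    h ▸ ⟨(inf_le_left : |f| ⊓ |g| ≤ |f|), (inf_le_right : |f| ⊓ |g| ≤ |g|),
      fun _ h1 h2 => (le_inf h1 h2 : _ ≤ |f| ⊓ |g|)⟩⟩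

theorem dualDisjointSeq_iff {f : ℕ → StrongDual ℝ E} : DualDisjointSeq f ↔ DisjointSeq f :=
  ⟨fun h n m hnm => (h n m hnm).inf_eq_zero,
    fun h n m hnm => dualDisjoint_of_inf_eq_zero (h n m hnm)⟩

end DualLattice

/-! ### Weakly null sequences. -/

section WeaklyNull

variable {X : Type*} [NormedAddCommGroup X] [NormedSpace ℝ X]

theorem weaklyNull_iff {x : ℕ → X} :
    WeaklyNull x ↔ ∀ φ : StrongDual ℝ X, Tendsto (fun n => φ (x n)) atTop (𝓝 0) := by
  have hinj : Function.Injective (topDualPairing ℝ X).flip := by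
    intro a b hab
    rw [← sub_eq_zero]
    refine SeparatingDual.eq_zero_of_forall_dual_eq_zero (R := ℝ) fun φ => ?_
    rw [map_sub, sub_eq_zero]
    exact LinearMap.congr_fun hab φ
  refine (WeakBilin.tendsto_iff_forall_eval_tendsto _ hinj).trans (forall_congr' fun φ => ?_)
  have : (topDualPairing ℝ X).flip (0 : X) φ = 0 := by simp
  exact iff_of_eq (congrArg (fun c => Tendsto (fun n => φ (x n)) atTop (𝓝 c)) this)

theorem WeaklyNull.exists_norm_le {x : ℕ → X} (hx : WeaklyNull x) : ∃ C, ∀ n, ‖x n‖ ≤ C := by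
  obtain ⟨C, hC⟩ := banach_steinhaus (g := fun n => NormedSpace.inclusionInDoubleDual ℝ X (x n))
    fun φ => by
      obtain ⟨C, hC⟩ := (weaklyNull_iff.1 hx φ).norm.bddAbove_range
      exact ⟨C, fun n => hC ⟨n, rfl⟩⟩
  refine ⟨C, fun n => (le_of_eq ?_).trans (hC n)⟩
  exact ((NormedSpace.inclusionInDoubleDualLi ℝ (E := X)).norm_map (x n)).symm

theorem WeaklyNull.comp_strictMono {x : ℕ → X} (hx : WeaklyNull x) {k : ℕ → ℕ}
    (hk : StrictMono k) : WeaklyNull fun n => x (k n) :=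
  hx.comp hk.tendsto_atTop

end WeaklyNull

/-! ### Moduli of combinations of disjoint vectors. -/

section Lattice

variable {E : Type*} [NormedAddCommGroup E] [NormedSpace ℝ E] [Lattice E]
  [IsOrderedAddMonoid E] [IsOrderedModule ℝ E]

theorem inf_add_eq_zero {u v w : E} (hu : 0 ≤ u) (hv : 0 ≤ v) (hw : 0 ≤ w) (huv : u ⊓ v = 0)
    (huw : u ⊓ w = 0) : u ⊓ (v + w) = 0 := by
  refine le_antisymm ?_ (le_inf hu (add_nonneg hv hw))
  have h1 : u ⊓ (v + w) - w ≤ u ⊓ v :=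
    le_inf ((sub_le_self _ hw).trans inf_le_left) (sub_le_iff_le_add.2 inf_le_right)
  rw [huv, sub_nonpos] at h1
  exact (le_inf inf_le_left h1).trans huw.le

theorem inf_smul_eq_zero {u v : E} (hu : 0 ≤ u) (hv : 0 ≤ v) (huv : u ⊓ v = 0) {c : ℝ}
    (hc : 0 ≤ c) : u ⊓ c • v = 0 := by
  refine le_antisymm ?_ (le_inf hu (smul_nonneg hc hv))
  have h1 : (0 : ℝ) < 1 + c := by linarith
  calc u ⊓ c • v ≤ ((1 + c) • u) ⊓ ((1 + c) • v) := by
        refine inf_le_inf ?_ ?_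
        · rw [add_smul, one_smul]
          exact le_add_of_nonneg_right (smul_nonneg hc hu)
        · rw [add_smul, one_smul]
          exact le_add_of_nonneg_left hv
    _ = (1 + c) • (u ⊓ v) := ((OrderIso.smulRight h1).map_inf u v).symm
    _ = 0 := by rw [huv, smul_zero]

theorem abs_add_of_inf_eq_zero {u v : E} (h : |u| ⊓ |v| = 0) : |u + v| = |u| + |v| := by
  refine le_antisymm (abs_add_le u v) ?_
  have h1 := abs_abs_sub_abs_le u (-v)
  rw [abs_neg, sub_neg_eq_add, abs_sub_comm, ← sup_sub_inf_eq_abs_sub, h, sub_zero] at h1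
  have h2 := inf_add_sup |u| |v|
  rw [h, zero_add] at h2
  exact h2 ▸ h1

/-- The two claims are proved by one induction: the modulus formula at the next index needs its
disjointness from the partial sum. -/
theorem DisjointSeq.abs_sum {x : ℕ → E} (hx : DisjointSeq x) (a : ℕ → ℝ) (s : Finset ℕ) :
    |∑ i ∈ s, a i • x i| = ∑ i ∈ s, |a i| • |x i| ∧
      ∀ m ∉ s, |x m| ⊓ |∑ i ∈ s, a i • x i| = 0 := by
  have habs : ∀ (c : ℝ) (y : E), |c • y| = |c| • |y| := fun c y => by
    rcases le_total 0 c with hc | hc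
    · rw [abs_smul_of_nonneg hc, abs_of_nonneg hc]
    · rw [abs_of_nonpos hc, ← abs_smul_of_nonneg (neg_nonneg.2 hc), neg_smul, abs_neg]
  induction s using Finset.induction_on with
  | empty => simp
  | insert j s hj ih =>
    have h1 : |x j| ⊓ |∑ i ∈ s, a i • x i| = 0 := ih.2 j hj
    have h2 : |a j • x j| ⊓ |∑ i ∈ s, a i • x i| = 0 := by
      rw [habs, inf_comm]
      exact inf_smul_eq_zero (abs_nonneg _) (abs_nonneg _) (by rwa [inf_comm]) (abs_nonneg _)
    rw [Finset.sum_insert hj, Finset.sum_insert hj, abs_add_of_inf_eq_zero h2, ih.1, habs]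
    refine ⟨rfl, fun m hm => ?_⟩
    rw [Finset.mem_insert, not_or] at hm
    rw [← ih.1]
    exact inf_add_eq_zero (abs_nonneg _) (smul_nonneg (abs_nonneg _) (abs_nonneg _))
      (abs_nonneg _) (inf_smul_eq_zero (abs_nonneg _) (abs_nonneg _) (hx m j hm.1) (abs_nonneg _))
      (ih.2 m hm.2)

end Lattice

/-! ### Weak nullity of moduli and its preservation by order bounded operators. -/

section BanachLattice

variable {E F : Type*} [NormedAddCommGroup E] [NormedSpace ℝ E] [CompleteSpace E] [Lattice E]
  [IsOrderedAddMonoid E] [IsOrderedModule ℝ E] [HasSolidNorm E]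
  [NormedAddCommGroup F] [NormedSpace ℝ F] [CompleteSpace F] [Lattice F]
  [IsOrderedAddMonoid F] [IsOrderedModule ℝ F] [HasSolidNorm F]

theorem weaklyNull_of_nonneg {x : ℕ → E}
    (h : ∀ φ : StrongDual ℝ E, 0 ≤ φ → Tendsto (fun n => φ |x n|) atTop (𝓝 0)) :
    WeaklyNull x :=
  weaklyNull_iff.2 fun φ => squeeze_zero_norm (fun n => abs_apply_le φ (x n))
    (h |φ| (abs_nonneg φ))

theorem WeaklyNull.of_abs_le {x y : ℕ → E} (hx : WeaklyNull x) (h : ∀ n, |y n| ≤ x n) :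
    WeaklyNull y :=
  weaklyNull_of_nonneg fun φ hφ =>
    squeeze_zero (fun n => dual_nonneg_iff.1 hφ _ (abs_nonneg (y n)))
      (fun n => apply_mono hφ (h n)) (weaklyNull_iff.1 hx φ)

/-- A disjoint weakly null sequence has weakly null moduli. -/
theorem WeaklyNull.abs {x : ℕ → E} (hx : WeaklyNull x) (hd : DisjointSeq x) :
    WeaklyNull fun n => |x n| := by
  refine weaklyNull_of_nonneg fun f hf => ?_
  simp only [abs_abs]
  -- The aim is one continuous functional `g` with `g (x n) = f |x n|` for all `n`. It is defined on
  -- the span of `x`, where disjointness bounds it by the sublinear map `f |·|`, and extended by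
  -- Hahn-Banach.
  let L : (ℕ →₀ ℝ) →ₗ[ℝ] E := Finsupp.linearCombination ℝ x
  let φ : (ℕ →₀ ℝ) →ₗ[ℝ] ℝ := Finsupp.linearCombination ℝ fun n => f |x n|
  have hφ : ∀ a, φ a ≤ f |L a| := by
    intro a
    have h1 : L a = ∑ i ∈ a.support, a i • x i := Finsupp.linearCombination_apply ℝ a
    have h2 : φ a = ∑ i ∈ a.support, a i • f |x i| := Finsupp.linearCombination_apply ℝ a
    rw [h1, h2, (hd.abs_sum a a.support).1, map_sum]
    refine Finset.sum_le_sum fun i _ => ?_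
    rw [map_smul, smul_eq_mul, smul_eq_mul]
    exact mul_le_mul_of_nonneg_right (le_abs_self _) (dual_nonneg_iff.1 hf _ (abs_nonneg _))
  -- The bound at `a` and `-a` forces `φ` to vanish where `L` does, so `φ` factors through `L`: the
  -- functional on the span is well defined.
  have hker : φ ∈ (LinearMap.ker L).dualAnnihilator := by
    rw [Submodule.mem_dualAnnihilator]
    intro a ha
    rw [LinearMap.mem_ker] at ha
    have h1 := hφ a
    have h2 := hφ (-a)
    rw [map_neg, map_neg, abs_neg] at h2
    rw [ha, abs_zero, map_zero] at h1 h2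
    linarith
  rw [← LinearMap.range_dualMap_eq_dualAnnihilator_ker] at hker
  obtain ⟨g₀, hg₀⟩ := hker
  have hg₀' : ∀ a, g₀ (L a) = φ a := fun a => LinearMap.congr_fun hg₀ a
  obtain ⟨g, hg1, hg2⟩ := exists_extension_of_le_sublinear
    ⟨LinearMap.range L, g₀.comp (LinearMap.range L).subtype⟩ (fun y => f |y|)
    (fun c hc y => by rw [abs_smul_of_nonneg hc.le, map_smul, smul_eq_mul])
    (fun y z => by
      rw [← map_add]
      exact apply_mono hf (abs_add_le y z))
    (by
      rintro ⟨_, a, rfl⟩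
      exact (hg₀' a).trans_le (hφ a))
  have hgc : ∀ y, ‖g y‖ ≤ ‖f‖ * ‖y‖ := by
    have h1 : ∀ y, g y ≤ ‖f‖ * ‖y‖ := fun y => (hg2 y).trans (by
      have := apply_le_norm_mul_norm f (abs_abs y).le
      rwa [norm_abs_eq_norm] at this)
    intro y
    rw [Real.norm_eq_abs, abs_le]
    have h2 := h1 (-y)
    rw [map_neg, norm_neg] at h2
    exact ⟨by linarith, h1 y⟩
  refine (weaklyNull_iff.1 hx (g.mkContinuous ‖f‖ hgc)).congr fun n => ?_
  have h1 : L (Finsupp.single n 1) = x n := by simp [L]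
  have h2 : φ (Finsupp.single n 1) = f |x n| := by simp [φ]
  have h3 := hg1 ⟨x n, Finsupp.single n 1, h1⟩
  rw [LinearMap.mkContinuous_apply, h3, ← h2, ← hg₀', h1]
  rfl

theorem IsOrderBounded.exists_le {T : E →L[ℝ] F} (hT : IsOrderBounded T) (x : E) :
    ∃ z, ∀ v, |v| ≤ x → T v ≤ z := by
  obtain ⟨a, b, h⟩ := hT (Set.Icc (-x) x) ⟨-x, x, le_rfl⟩
  exact ⟨b, fun v hv => (h ⟨v, ⟨neg_le.1 ((neg_le_abs v).trans hv), (le_abs_self v).trans hv⟩,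
    rfl⟩).2⟩

/-- The hypothesis is a one-sided form of order boundedness, which adjoints also satisfy by
`exists_le_precomp`; the lemma thus serves `T` and its adjoint alike. -/
theorem exists_dominating (T : E →L[ℝ] F) (hT : ∀ x, 0 ≤ x → ∃ z, ∀ v, |v| ≤ x → T v ≤ z)
    {f : StrongDual ℝ F} (hf : 0 ≤ f) :
    ∃ h : StrongDual ℝ E, 0 ≤ h ∧ ∀ y, f |T y| ≤ h |y| := by
  obtain ⟨h, hh⟩ := exists_isLUB_listSums_comp (T : E →ₗ[ℝ] F) (f : F →ₗ[ℝ] ℝ)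
    (dual_nonneg_iff.1 hf) hT
  have key := apply_abs_le_of_isLUB (T : E →ₗ[ℝ] F) (f : F →ₗ[ℝ] ℝ) (dual_nonneg_iff.1 hf) hh
  refine ⟨h, fun x hx => ?_, key⟩
  have h1 := key x
  rw [abs_of_nonneg hx] at h1
  exact (dual_nonneg_iff.1 hf _ (abs_nonneg _)).trans h1

theorem exists_le_precomp {T : E →L[ℝ] F} (hT : IsOrderBounded T) (f : StrongDual ℝ F)
    (hf : 0 ≤ f) : ∃ h, ∀ g : StrongDual ℝ F, |g| ≤ f →
      ContinuousLinearMap.precomp ℝ T g ≤ h := by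
  obtain ⟨h, -, hh⟩ := exists_dominating T (fun x _ => hT.exists_le x) hf
  refine ⟨h, fun g hg x hx => ?_⟩
  calc g (T x) ≤ |g| |T x| := (le_abs_self _).trans (abs_apply_le g _)
    _ ≤ f |T x| := hg _ (abs_nonneg _)
    _ ≤ h |x| := hh x
    _ = h x := by rw [abs_of_nonneg hx]

theorem WeaklyNull.abs_map (T : E →L[ℝ] F) (hT : ∀ x, 0 ≤ x → ∃ z, ∀ v, |v| ≤ x → T v ≤ z)
    {x : ℕ → E} (hx : WeaklyNull fun n => |x n|) : WeaklyNull fun n => |T (x n)| := by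
  refine weaklyNull_of_nonneg fun f hf => ?_
  simp only [abs_abs]
  obtain ⟨h, -, hh⟩ := exists_dominating T hT hf
  exact squeeze_zero (fun n => dual_nonneg_iff.1 hf _ (abs_nonneg _)) (fun n => hh (x n))
    (weaklyNull_iff.1 hx h)

end BanachLattice

/-! ### Replacing a positive weakly null sequence by a disjoint one. -/

section Disjointification

variable {A B : Type*} [NormedAddCommGroup A] [NormedSpace ℝ A] [CompleteSpace A] [Lattice A]
  [IsOrderedAddMonoid A] [IsOrderedModule ℝ A] [HasSolidNorm A]
  [NormedAddCommGroup B] [NormedSpace ℝ B] [CompleteSpace B] [Lattice B]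
  [IsOrderedAddMonoid B] [IsOrderedModule ℝ B] [HasSolidNorm B]

/-- Sequences with `f i ≤ U n` for `i < n` and `(1 / 2) ^ i • f i ≤ F` are made disjoint by
subtracting `4 ^ n • U n` and `(1 / 2) ^ n • F`. -/
theorem disjointSeq_posPart {f U : ℕ → B} {F : B} (hf : ∀ n, 0 ≤ f n)
    (hU : ∀ n i, i < n → f i ≤ U n) (hU0 : ∀ n, 0 ≤ U n) (hF0 : 0 ≤ F)
    (hF : ∀ n, (1 / 2 : ℝ) ^ n • f n ≤ F) :
    DisjointSeq fun n => (f n - ((4 : ℝ) ^ n • U n + (1 / 2 : ℝ) ^ n • F))⁺ := by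
  have key : ∀ n m, n < m → (f n - ((4 : ℝ) ^ n • U n + (1 / 2 : ℝ) ^ n • F))⁺ ⊓
      (f m - ((4 : ℝ) ^ m • U m + (1 / 2 : ℝ) ^ m • F))⁺ = 0 := by
    intro n m hnm
    -- For `n < m` the `m`-th term lies below `d⁺` because `f n ≤ U m`, and the `n`-th below `d⁻`
    -- because `(1 / 2) ^ n • F` dominates `(1 / 4) ^ m • f m`. Positive and negative parts of `d`
    -- are disjoint.
    set d := f m - (4 : ℝ) ^ m • f n with hd
    have h1 : (f m - ((4 : ℝ) ^ m • U m + (1 / 2 : ℝ) ^ m • F))⁺ ≤ d⁺ := by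
      refine posPart_mono (sub_le_sub_left ?_ _)
      refine (smul_le_smul_of_nonneg_left (hU m n hnm) (by positivity)).trans ?_
      exact le_add_of_nonneg_right (smul_nonneg (by positivity) hF0)
    have h2 : (f n - ((4 : ℝ) ^ n • U n + (1 / 2 : ℝ) ^ n • F))⁺ ≤ d⁻ := by
      refine sup_le ?_ (negPart_nonneg d)
      calc f n - ((4 : ℝ) ^ n • U n + (1 / 2 : ℝ) ^ n • F)
          ≤ f n - (1 / 4 : ℝ) ^ m • f m := by
            refine sub_le_sub_left ?_ _
            calc (1 / 4 : ℝ) ^ m • f m ≤ ((1 / 2 : ℝ) ^ n * (1 / 2 : ℝ) ^ m) • f m := by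
                  refine smul_le_smul_of_nonneg_right ?_ (hf m)
                  rw [show (1 / 4 : ℝ) = 1 / 2 * (1 / 2) by norm_num, mul_pow]
                  refine mul_le_mul_of_nonneg_right ?_ (by positivity)
                  exact pow_le_pow_of_le_one (by norm_num) (by norm_num) hnm.le
              _ = (1 / 2 : ℝ) ^ n • (1 / 2 : ℝ) ^ m • f m := mul_smul _ _ _
              _ ≤ (1 / 2 : ℝ) ^ n • F := smul_le_smul_of_nonneg_left (hF m) (by positivity)
              _ ≤ _ := le_add_of_nonneg_left (smul_nonneg (by positivity) (hU0 n))
        _ = (1 / 4 : ℝ) ^ m • -d := by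
            rw [hd, neg_sub, smul_sub, smul_smul, ← mul_pow]
            norm_num
        _ ≤ (1 / 4 : ℝ) ^ m • d⁻ :=
            smul_le_smul_of_nonneg_left (neg_le_negPart d) (by positivity)
        _ ≤ (1 : ℝ) • d⁻ := smul_le_smul_of_nonneg_right
            (pow_le_one₀ (by norm_num) (by norm_num)) (negPart_nonneg d)
        _ = d⁻ := one_smul _ _
    refine le_antisymm ?_ (le_inf (posPart_nonneg _) (posPart_nonneg _))
    calc _ ≤ d⁻ ⊓ d⁺ := inf_le_inf h2 h1
      _ = 0 := by rw [inf_comm, posPart_inf_negPart_eq_zero]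
  intro n m hnm
  simp only [abs_of_nonneg (posPart_nonneg _)]
  rcases hnm.lt_or_gt with h | h
  · exact key n m h
  · rw [inf_comm]
    exact key m n h

/-- Here `U n` is the sum of the terms `f (k i)` with `i < n`. It is known before `k n` is chosen,
so weak nullity of `|x|` allows `k n` to be taken large enough for the functional attached to `4 ^ n
• U n`. -/
theorem exists_subseq {x : ℕ → A} (hx : WeaklyNull fun n => |x n|) {f : ℕ → B}
    (hf : ∀ n, 0 ≤ f n) (h : B → StrongDual ℝ A) :
    ∃ (k : ℕ → ℕ) (U : ℕ → B), StrictMono k ∧ (∀ n, 0 ≤ U n) ∧ (∀ n i, i < n → f (k i) ≤ U n) ∧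
      ∀ n, h ((4 : ℝ) ^ n • U n) |x (k n)| < (1 / 2) ^ n := by
  have hstep : ∀ (u : B) (n m : ℕ), ∃ k, m < k ∧ h ((4 : ℝ) ^ n • u) |x k| < (1 / 2) ^ n := by
    intro u n m
    have h1 := (weaklyNull_iff.1 hx (h ((4 : ℝ) ^ n • u))).eventually_lt_const
      (show (0 : ℝ) < (1 / 2) ^ n by positivity)
    exact ((eventually_gt_atTop m).and h1).exists
  choose K hK1 hK2 using hstep
  -- The state holds the sum of the terms chosen so far and the last index chosen, so `k n` is read
  -- off from `s (n + 1)` and `U n` from `s n`.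
  let s : ℕ → B × ℕ := fun n =>
    Nat.rec (0, 0) (fun n p => (p.1 + f (K p.1 n p.2), K p.1 n p.2)) n
  have hmono : Monotone fun n => (s n).1 :=
    monotone_nat_of_le_succ fun n => le_add_of_nonneg_right (hf _)
  refine ⟨fun n => (s (n + 1)).2, fun n => (s n).1, strictMono_nat_of_lt_succ fun n => hK1 _ _ _,
    fun n => hmono (Nat.zero_le n), fun n i hi => ?_, fun n => hK2 _ _ _⟩
  exact (le_add_of_nonneg_left (hmono (Nat.zero_le i))).trans (hmono (Nat.succ_le_of_lt hi))

/-- The part removed from `f (k n)` is `f (k n) ⊓ (p + q)` with `p = 4 ^ n • U n` and `q = (1 / 2) ^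
n • F`. It splits into a piece below `p`, negligible by the choice of `k n`, and a piece below `q`,
negligible because of the factor `(1 / 2) ^ n`. -/
theorem exists_disjoint_approx (b : A →ₗ[ℝ] B →ₗ[ℝ] ℝ)
    (hb : ∀ f : B, 0 ≤ f → ∃ h : StrongDual ℝ A, ∀ y g, |g| ≤ f → |b y g| ≤ h |y|)
    {x : ℕ → A} (hx : WeaklyNull fun n => |x n|) {f : ℕ → B} (hf : ∀ n, 0 ≤ f n)
    (hfw : WeaklyNull f) :
    ∃ (k : ℕ → ℕ) (g : ℕ → B), StrictMono k ∧ WeaklyNull g ∧ DisjointSeq g ∧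
      Tendsto (fun n => b (x (k n)) (f (k n)) - b (x (k n)) (g n)) atTop (𝓝 0) := by
  have hb' : ∀ f : B, ∃ h : StrongDual ℝ A, 0 ≤ f → ∀ y g, |g| ≤ f → |b y g| ≤ h |y| := by
    intro f
    by_cases hf : 0 ≤ f
    · exact (hb f hf).imp fun _ h _ => h
    · exact ⟨0, fun h => absurd h hf⟩
  choose h hh using hb'
  obtain ⟨k, U, hk, hU0, hU, hxU⟩ := exists_subseq hx hf h
  obtain ⟨C, hC⟩ := hfw.exists_norm_le
  have hs : Summable fun n => (1 / 2 : ℝ) ^ n • f (k n) := by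
    refine Summable.of_norm_bounded (summable_geometric_two.mul_right C) fun n => ?_
    rw [norm_smul, Real.norm_of_nonneg (by positivity)]
    exact mul_le_mul_of_nonneg_left (hC _) (by positivity)
  have hnn : ∀ n, 0 ≤ (1 / 2 : ℝ) ^ n • f (k n) := fun n => smul_nonneg (by positivity) (hf _)
  set F := ∑' n, (1 / 2 : ℝ) ^ n • f (k n)
  have hF0 : 0 ≤ F := tsum_nonneg hnn
  have hF : ∀ n, (1 / 2 : ℝ) ^ n • f (k n) ≤ F := fun n => hs.le_tsum n fun m _ => hnn m
  refine ⟨k, fun n => (f (k n) - ((4 : ℝ) ^ n • U n + (1 / 2 : ℝ) ^ n • F))⁺, hk, ?_,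
    disjointSeq_posPart (fun n => hf _) hU hU0 hF0 hF, ?_⟩
  · refine (hfw.comp_strictMono hk).of_abs_le fun n => ?_
    rw [abs_of_nonneg (posPart_nonneg _)]
    refine sup_le (sub_le_self _ ?_) (hf _)
    exact add_nonneg (smul_nonneg (by positivity) (hU0 n)) (smul_nonneg (by positivity) hF0)
  · have hlim : Tendsto (fun n => (1 / 2 : ℝ) ^ n + (1 / 2 : ℝ) ^ n * h F |x (k n)|) atTop
        (𝓝 0) := by
      have h1 := tendsto_pow_atTop_nhds_zero_of_lt_one (r := (1 / 2 : ℝ)) (by norm_num)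
        (by norm_num)
      simpa using h1.add (h1.mul (weaklyNull_iff.1 (hx.comp_strictMono hk) (h F)))
    refine squeeze_zero_norm (fun n => ?_) hlim
    set p := (4 : ℝ) ^ n • U n
    set q := (1 / 2 : ℝ) ^ n • F with hq
    have hp0 : 0 ≤ p := smul_nonneg (by positivity) (hU0 n)
    have hq0 : 0 ≤ q := smul_nonneg (by positivity) hF0
    have hr : f (k n) - (f (k n) - (p + q))⁺ = f (k n) ⊓ (p + q) :=
      (inf_eq_sub_posPart_sub _ _).symm
    set r := f (k n) ⊓ (p + q) with hrdef
    have hr0 : 0 ≤ r := le_inf (hf _) (add_nonneg hp0 hq0)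
    have hr1 : |b (x (k n)) (r ⊓ p)| ≤ (1 / 2) ^ n := by
      refine (hh p hp0 _ _ ?_).trans (hxU n).le
      rw [abs_of_nonneg (le_inf hr0 hp0)]
      exact inf_le_right
    have hr2 : |b (x (k n)) (r - r ⊓ p)| ≤ (1 / 2) ^ n * h F |x (k n)| := by
      -- The choice of `h` need not be homogeneous, so the piece below `q` is rescaled to lie below
      -- the fixed vector `F`, and only `h F` is used.
      have h2 : |(2 : ℝ) ^ n • (r - r ⊓ p)| ≤ F := by
        have h3 : r - r ⊓ p ≤ q := by
          rw [sub_inf, sub_self]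
          exact sup_le hq0 (sub_le_iff_le_add'.2 inf_le_right)
        rw [abs_of_nonneg (smul_nonneg (by positivity) (sub_nonneg.2 inf_le_left))]
        refine (smul_le_smul_of_nonneg_left h3 (by positivity)).trans (le_of_eq ?_)
        rw [hq, smul_smul, ← mul_pow]
        norm_num
      have h4 := hh F hF0 (x (k n)) _ h2
      rw [map_smul, smul_eq_mul, abs_mul, abs_of_nonneg (by positivity)] at h4
      calc |b (x (k n)) (r - r ⊓ p)|
          = (1 / 2) ^ n * (2 ^ n * |b (x (k n)) (r - r ⊓ p)|) := by
            rw [← mul_assoc, ← mul_pow]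
            norm_num
        _ ≤ _ := mul_le_mul_of_nonneg_left h4 (by positivity)
    rw [← map_sub, hr]
    calc ‖b (x (k n)) r‖ = |b (x (k n)) (r ⊓ p) + b (x (k n)) (r - r ⊓ p)| := by
          rw [← map_add, add_sub_cancel, Real.norm_eq_abs]
      _ ≤ _ := (abs_add_le _ _).trans (add_le_add hr1 hr2)

/-- Convergence of a bilinear form along two sequences with weakly null moduli only has to be
checked when the second sequence is disjoint. -/
theorem tendsto_of_forall_disjoint (b : A →ₗ[ℝ] B →ₗ[ℝ] ℝ)
    (hb : ∀ f : B, 0 ≤ f → ∃ h : StrongDual ℝ A, ∀ y g, |g| ≤ f → |b y g| ≤ h |y|)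
    {x : ℕ → A} (hx : WeaklyNull fun n => |x n|) {f : ℕ → B} (hf : WeaklyNull fun n => |f n|)
    (H : ∀ (k : ℕ → ℕ) (g : ℕ → B), StrictMono k → WeaklyNull g → DisjointSeq g →
      Tendsto (fun n => b (x (k n)) (g n)) atTop (𝓝 0)) :
    Tendsto (fun n => b (x n) (f n)) atTop (𝓝 0) := by
  have key : ∀ f : ℕ → B, (∀ n, 0 ≤ f n) → WeaklyNull f →
      Tendsto (fun n => b (x n) (f n)) atTop (𝓝 0) := by
    intro f hf hfw
    -- Disjointification works only along subsequences, which suffices: every subsequence needs a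
    -- further one with limit zero.
    refine tendsto_of_subseq_tendsto fun ns hns => ?_
    obtain ⟨j, -, hj⟩ := strictMono_subseq_of_tendsto_atTop hns
    obtain ⟨k, g, hk, hg1, hg2, hlim⟩ := exists_disjoint_approx b hb (hx.comp_strictMono hj)
      (fun n => hf (ns (j n))) (hfw.comp_strictMono hj)
    refine ⟨j ∘ k, ?_⟩
    have h1 := hlim.add (H _ g (hj.comp hk) hg1 hg2)
    simpa using h1
  have h1 := key (fun n => (f n)⁺) (fun n => posPart_nonneg _) (hf.of_abs_le fun n => by
    rw [abs_of_nonneg (posPart_nonneg _)]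
    exact sup_le (le_abs_self _) (abs_nonneg _))
  have h2 := key (fun n => (f n)⁻) (fun n => negPart_nonneg _) (hf.of_abs_le fun n => by
    rw [abs_of_nonneg (negPart_nonneg _)]
    exact sup_le (neg_le_abs _) (abs_nonneg _))
  have h3 := h1.sub h2
  rw [sub_zero] at h3
  refine h3.congr fun n => ?_
  rw [← map_sub, posPart_sub_negPart]

end Disjointification

/-! ### Order bounded awDP operators: products and limits. -/

section Main

variable {E F : Type*} [NormedAddCommGroup E] [NormedSpace ℝ E] [CompleteSpace E] [Lattice E]
  [IsOrderedAddMonoid E] [IsOrderedModule ℝ E] [HasSolidNorm E]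
  [NormedAddCommGroup F] [NormedSpace ℝ F] [CompleteSpace F] [Lattice F]
  [IsOrderedAddMonoid F] [IsOrderedModule ℝ F] [HasSolidNorm F]

/-- For an order bounded almost weak Dunford-Pettis operator, disjointness of the two sequences
may be weakened to weak convergence of the moduli. -/
theorem IsAWDP.tendsto {T : E →L[ℝ] F} (hT : IsAWDP T) (hob : IsOrderBounded T) {x : ℕ → E}
    {f : ℕ → StrongDual ℝ F} (hx : WeaklyNull fun n => |x n|) (hf : WeaklyNull fun n => |f n|) :
    Tendsto (fun n => f n (T (x n))) atTop (𝓝 0) := by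
  let b : StrongDual ℝ F →ₗ[ℝ] E →ₗ[ℝ] ℝ :=
    { toFun := fun g => (g : F →ₗ[ℝ] ℝ).comp (T : E →ₗ[ℝ] F)
      map_add' := fun _ _ => rfl
      map_smul' := fun _ _ => rfl }
  -- Domination for the adjoint of `T`, with `u` regarded as a positive functional on `E'`.
  have hb : ∀ u : E, 0 ≤ u → ∃ h : StrongDual ℝ (StrongDual ℝ F),
      ∀ g y, |y| ≤ u → |b g y| ≤ h |g| := by
    intro u hu
    obtain ⟨h, -, hh⟩ := exists_dominating (ContinuousLinearMap.precomp ℝ T)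
      (exists_le_precomp hob) (f := NormedSpace.inclusionInDoubleDual ℝ E u)
      (fun g hg => hg u hu)
    refine ⟨h, fun g y hy => ?_⟩
    calc |b g y| ≤ |ContinuousLinearMap.precomp ℝ T g| |y| :=
          abs_apply_le (ContinuousLinearMap.precomp ℝ T g) y
      _ ≤ |ContinuousLinearMap.precomp ℝ T g| u := apply_mono (abs_nonneg _) hy
      _ ≤ h |g| := hh g
  have hb' : ∀ f : StrongDual ℝ F, 0 ≤ f → ∃ h : StrongDual ℝ E,
      ∀ y g, |g| ≤ f → |b.flip y g| ≤ h |y| := by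
    intro f hf
    obtain ⟨h, -, hh⟩ := exists_dominating T (fun x _ => hob.exists_le x) hf
    refine ⟨h, fun y g hg => ?_⟩
    calc |b.flip y g| ≤ |g| |T y| := abs_apply_le g (T y)
      _ ≤ f |T y| := hg _ (abs_nonneg _)
      _ ≤ h |y| := hh y
  -- The functionals are made disjoint first. Passing to a subsequence keeps them disjoint when the
  -- vectors are treated next.
  refine tendsto_of_forall_disjoint b.flip hb' hx hf fun k g hk hg hgd => ?_
  refine tendsto_of_forall_disjoint b hb (hg.abs hgd) (hx.comp_strictMono hk)
    fun j y hj hy hyd => ?_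
  exact hT y _ hy hyd (hg.comp_strictMono hj)
    (dualDisjointSeq_iff.2 fun n m hnm => hgd _ _ (hj.injective.ne hnm))

/-- Moving `S` to the functionals by its adjoint keeps their moduli weakly null, though perhaps not
their disjointness; `IsAWDP.tendsto` needs only the former. -/
theorem IsAWDP.comp_left {T S : E →L[ℝ] E} (hT : IsAWDP T) (hob : IsOrderBounded T)
    (hS : IsOrderBounded S) : IsAWDP (S.comp T) := by
  intro x f hx hxd hf hfd
  exact hT.tendsto hob (hx.abs hxd) (WeaklyNull.abs_map (ContinuousLinearMap.precomp ℝ S)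
    (exists_le_precomp hS) (hf.abs (dualDisjointSeq_iff.1 hfd)))

theorem IsAWDP.comp_right {T S : E →L[ℝ] E} (hT : IsAWDP T) (hob : IsOrderBounded T)
    (hS : IsOrderBounded S) : IsAWDP (T.comp S) := by
  intro x f hx hxd hf hfd
  exact hT.tendsto hob (WeaklyNull.abs_map S (fun x _ => hS.exists_le x) (hx.abs hxd))
    (hf.abs (dualDisjointSeq_iff.1 hfd))

theorem isClosed_setOf_isAWDP : IsClosed {T : E →L[ℝ] F | IsAWDP T} := by
  refine isClosed_of_closure_subset fun T hT x f hx hxd hf hfd => ?_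
  obtain ⟨C, hC⟩ := hx.exists_norm_le
  obtain ⟨D, hD⟩ := hf.exists_norm_le
  have hC0 : 0 ≤ C := (norm_nonneg _).trans (hC 0)
  have hD0 : 0 ≤ D := (norm_nonneg _).trans (hD 0)
  rw [Metric.tendsto_atTop]
  intro ε hε
  -- Since `‖f n‖ ≤ D` and `‖x n‖ ≤ C`, replacing `T` by `S` costs at most `ε / 2` uniformly in `n`;
  -- the `+ 1` keeps the denominator positive.
  obtain ⟨S, hS, hTS⟩ := Metric.mem_closure_iff.1 hT (ε / (2 * (D * C + 1))) (by positivity)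
  rw [dist_eq_norm] at hTS
  obtain ⟨N, hN⟩ := Metric.tendsto_atTop.1 (hS x f hx hxd hf hfd) (ε / 2) (by positivity)
  refine ⟨N, fun n hn => ?_⟩
  have h1 := hN n hn
  rw [dist_zero_right] at h1 ⊢
  have h2 : ‖f n ((T - S) (x n))‖ ≤ D * C * ‖T - S‖ := by
    calc ‖f n ((T - S) (x n))‖ ≤ ‖f n‖ * (‖T - S‖ * ‖x n‖) :=
          (f n).le_opNorm_of_le ((T - S).le_opNorm _)
      _ ≤ D * (‖T - S‖ * C) := by
          gcongr
          exacts [hD n, hC n]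
      _ = _ := by ring
  have h3 : D * C * ‖T - S‖ ≤ ε / 2 := by
    calc D * C * ‖T - S‖ ≤ (D * C + 1) * (ε / (2 * (D * C + 1))) := by
          gcongr
          linarith
      _ = ε / 2 := by
          field_simp
  have h4 : f n (T (x n)) = f n ((T - S) (x n)) + f n (S (x n)) := by
    rw [← map_add, sub_apply, sub_add_cancel]
  rw [h4]
  calc _ ≤ _ := norm_add_le _ _
    _ < ε := by linarith

end Main

end AlmostWeakDP

theorem corollary2p4 (E : Type*) [NormedAddCommGroup E] [NormedSpace ℝ E] [CompleteSpace E]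
    [Lattice E] [IsOrderedAddMonoid E] [IsOrderedModule ℝ E] [HasSolidNorm E] :
    ∃ I : TwoSidedIdeal (AlmostWeakDP.orderBoundedOperators E),
      (∀ T : AlmostWeakDP.orderBoundedOperators E,
        T ∈ I ↔ AlmostWeakDP.IsAWDP (T : E →L[ℝ] E)) ∧
      IsClosed {T : AlmostWeakDP.orderBoundedOperators E | T ∈ I} := by
  obtain ⟨I, hI⟩ : ∃ I : TwoSidedIdeal (AlmostWeakDP.orderBoundedOperators E),
      ∀ T : AlmostWeakDP.orderBoundedOperators E,
        T ∈ I ↔ AlmostWeakDP.IsAWDP (T : E →L[ℝ] E) := by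
    refine ⟨TwoSidedIdeal.mk' {T | AlmostWeakDP.IsAWDP (T : E →L[ℝ] E)} ?_ ?_ ?_ ?_ ?_,
      fun T => TwoSidedIdeal.mem_mk' ..⟩
    · intro x f _ _ _ _
      exact tendsto_const_nhds.congr fun n => (map_zero (f n)).symm
    · intro S T hS hT x f hx hxd hf hfd
      simpa using (hS x f hx hxd hf hfd).add (hT x f hx hxd hf hfd)
    · intro T hT x f hx hxd hf hfd
      simpa using (hT x f hx hxd hf hfd).neg
    · intro S T hT
      exact hT.comp_left T.2 S.2
    · intro T S hT
      exact hT.comp_right T.2 S.2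
  refine ⟨I, hI, ?_⟩
  simp only [hI]
  exact AlmostWeakDP.isClosed_setOf_isAWDP.preimage continuous_subtype_val
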